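/- In a graph with (some of) its vertices coloured, a path is vertex-proper if its internal vertices are coloured and any two internal vertices adjacent on the path have different colours. For a graph $G$ and $k\ge 1$, $pvc_k(G)$ is the smallest number of colours with which the vertices of $G$ can be coloured so that any two distinct vertices are joined by $k$ different, pairwise internally vertex-disjoint, vertex-proper paths. Let $t\ge 3$, $1\le n_1\le\cdots\le n_t$ with $n_t\ge 2$, let $m=\sum_{i=1}^{t-1}n_i$, and let $G=K_{n_1,\ldots,n_t}$ be the complete multipartite graph with classes of sizes $n_1,\ldots,n_t$. (a) Let $1\le k\le m-2$. (i) $pvc_k(G)=1$ if $k\le m-n_{t-1}+1$. (ii) $pvc_k(G)=2$ if $k\ge m-n_{t-1}+2$. (b) (i) $pvc_{m-1}(G)=1$ if $n_{t-1}\le 2$. (ii) $pvc_{m-1}(G)=2$ if $n_{t-1}\ge 3$ and it is not the case that $n_t=n_{t-1}=n_{t-2}$ is odd. (iii) $pvc_{m-1}(G)=3$ if $n_t=n_{t-1}=n_{t-2}\ge 3$ is odd. (c) (i) $pvc_m(G)=1$ if $n_{t-1}=1$. (ii) $pvc_m(G)=2$ if $2\le n_{t-1}\le n_t-2$. (iii)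 $pvc_m(G)=2$ if either $n_{t-1}=n_t-1\ge 2$ and $n_{t-2}\le 2$, or $n_{t-1}=n_t\ge 2$ and $n_{t-2}=1$. (iv) $pvc_m(G)=3$ if either $n_{t-1}=n_t-1$ and $n_{t-2}\ge 3$, or $n_{t-1}=n_t\ge 3$ and $n_{t-2}\ge 2$, except when $t\ge 4$ and $n_t=n_{t-1}=n_{t-2}=n_{t-3}=4$. (v) $pvc_m(G)=4$ if $t\ge 4$ and $n_t=n_{t-1}=n_{t-2}=n_{t-3}=4$. (vi) $pvc_m(G)=s$ if $1\le s\le t$, $n_t=n_{t-1}=\cdots=n_{t-s+1}=2$ and $n_{t-s}=\cdots=n_1=1$. -/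

import Mathlib

/-- Colourings with `n` colours are partial, `none` meaning that a vertex gets no colour, and
a vertex-proper path must have all its internal vertices coloured, with two internal vertices that
are adjacent on the path coloured differently. For `n ≥ 1` uncoloured vertices may be coloured
arbitrarily, so that total colourings suffice; for `n = 0` exactly the paths without
internal vertices are vertex-proper (so the complete graph needs `0` colours for `k = 1`). -/
def SimpleGraph.Walk.IsVertexProper {V : Type*} {G : SimpleGraph V} {u v : V} (p : G.Walk u v)
    {n : ℕ} (c : V → Option (Fin n)) : Prop :=
  (∀ a ∈ p.support, a ≠ u → a ≠ v → c a ≠ none) ∧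
  ∀ a b : V, s(a, b) ∈ p.edges → a ≠ u → a ≠ v → b ≠ u → b ≠ v → c a ≠ c b

/-- Any two distinct vertices are joined by `k` different, pairwise internally disjoint,
vertex-proper paths. -/
def SimpleGraph.IsProperVertexConnected {V : Type*} (G : SimpleGraph V) (k : ℕ) {n : ℕ}
    (c : V → Option (Fin n)) : Prop :=
  ∀ u v : V, u ≠ v → ∃ P : Fin k → G.Path u v, Function.Injective P ∧
    (∀ i, (P i : G.Walk u v).IsVertexProper c) ∧
    ∀ i j, i ≠ j → ∀ w, w ∈ (P i : G.Walk u v).support → w ∈ (P j : G.Walk u v).support →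
      w = u ∨ w = v

/-- The proper vertex `k`-connection number: the least number of colours with which the graph can
be made proper vertex `k`-connected (`0` is also the junk value if there is none). -/
noncomputable def SimpleGraph.pvc {V : Type*} (G : SimpleGraph V) (k : ℕ) : ℕ :=
  sInf {n : ℕ | ∃ c : V → Option (Fin n), G.IsProperVertexConnected k c}

/-- The complete multipartite graph with `t` classes of sizes `n 1, …, n t`. -/
def completeMultipartite (t : ℕ) (n : ℕ → ℕ) :
    SimpleGraph (Σ i : Fin t, Fin (n (i.val + 1))) :=
  SimpleGraph.completeMultipartiteGraph (fun i : Fin t => Fin (n (i.val + 1)))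

/-!
Let `N` be the number of vertices, let `k ≤ m = N - n t`, and consider a colouring with at least one
colour. Two vertices in the same class have at least `m` common neighbours, so the paths of length
two join them. Let `u`, `v` lie in different classes `V_i`, `V_j`. For a colour `x`, let `S` be the
set of vertices of colour `x` in `(V_i ∪ V_j) \ {u, v}`. No vertex-proper path from `u` to `v` has
all its internal vertices in `S`, unless it is the edge `u v`; therefore `k` internally disjoint
ones force `#S + k < N` (`SimpleGraph.card_add_lt_of_path_family`). Conversely, if this holds for
all colours, then Hall's theorem gives a matching of differently coloured vertices between
`V_i \ {u}` and `V_j \ {v}` which is so large that the edge `u v`, the paths of length two and the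
paths of length three through the matching edges are `k` paths in total
(`SimpleGraph.isProperVertexConnected_of_card_classmates_lt`).

Letting `u` and `v` vary, the largest `#S` is the sum of the loads of `x` in the two classes, where
the load is `min (number of vertices of colour x in V_i) (n i - 1)`: the removed vertex may be
chosen to have another colour, unless the class is monochromatic. So `pvc (m - d) ≤ s` holds for
`s ≥ 1` if and only if there is a colouring with `s` colours such that the loads of any colour in
any two classes have sum less than `n t + d` (`exists_isProperVertexConnected_iff`). What remains
are explicit colourings (halves, thirds, or monochromatic classes), and counting in the largest
three or four classes for the lower bounds.
-/

namespace SimpleGraph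

/-! ### Families of vertex-proper paths -/

section Families

variable {V : Type*} {G : SimpleGraph V} {u v : V} {s : ℕ} {c : V → Option (Fin s)}

/-- A family of `k` paths is described by the lists of internal vertices. -/
theorem exists_path_family {κ : Type*} [Fintype κ] {k : ℕ} (hk : k ≤ Fintype.card κ)
    (l : κ → List V) (hinj : Function.Injective l)
    (hdisj : ∀ i j, i ≠ j → (l i).Disjoint (l j))
    (hl : ∀ i, ∃ p : G.Path u v, (p : G.Walk u v).support = u :: (l i ++ [v]) ∧
      (p : G.Walk u v).IsVertexProper c) :
    ∃ P : Fin k → G.Path u v, Function.Injective P ∧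
      (∀ i, (P i : G.Walk u v).IsVertexProper c) ∧
      ∀ i j, i ≠ j → ∀ w, w ∈ (P i : G.Walk u v).support → w ∈ (P j : G.Walk u v).support →
        w = u ∨ w = v := by
  choose P hP hc using hl
  obtain ⟨e⟩ := Function.Embedding.nonempty_of_card_le
    (show Fintype.card (Fin k) ≤ Fintype.card κ by simpa using hk)
  refine ⟨fun i => P (e i), ?_, fun i => hc _, ?_⟩
  · intro i j hij
    have h := hP (e i)
    simp only at hij
    rw [hij, hP (e j)] at h
    simp only [List.cons.injEq, List.append_cancel_right_eq, true_and] at h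
    exact e.injective (hinj h.symm)
  · intro i j hij w hi hj
    rw [hP] at hi hj
    have hd := hdisj (e i) (e j) (fun h => hij (e.injective h))
    simp only [List.mem_cons, List.mem_append, List.not_mem_nil, or_false] at hi hj
    by_contra! hw
    exact hd (by tauto : w ∈ l (e i)) (by tauto)

theorem exists_path_length_one (h : G.Adj u v) :
    ∃ p : G.Path u v, (p : G.Walk u v).support = u :: ([] ++ [v]) ∧
      (p : G.Walk u v).IsVertexProper c := by
  refine ⟨⟨.cons h .nil, by simp [h.ne]⟩, by simp, ?_, ?_⟩
  · intro a ha hau hav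
    simp only [Walk.support_cons, Walk.support_nil, List.mem_cons, List.not_mem_nil, or_false]
      at ha
    tauto
  · intro a b hab
    simp only [Walk.edges_cons, Walk.edges_nil, List.mem_cons, List.not_mem_nil, or_false,
      Sym2.eq_iff] at hab
    tauto

theorem exists_path_length_two {w : V} (huv : u ≠ v) (h : G.Adj u w) (h' : G.Adj w v)
    (hw : c w ≠ none) :
    ∃ p : G.Path u v, (p : G.Walk u v).support = u :: ([w] ++ [v]) ∧
      (p : G.Walk u v).IsVertexProper c := by
  refine ⟨⟨.cons h (.cons h' .nil), by simp [h.ne, h'.ne, huv]⟩, by simp, ?_, ?_⟩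
  · intro a ha hau hav
    simp only [Walk.support_cons, Walk.support_nil, List.mem_cons, List.not_mem_nil, or_false]
      at ha
    obtain rfl : a = w := by tauto
    exact hw
  · intro a b hab
    simp only [Walk.edges_cons, Walk.edges_nil, List.mem_cons, List.not_mem_nil, or_false,
      Sym2.eq_iff] at hab
    tauto

theorem exists_path_length_three {b a : V} (huv : u ≠ v) (h₁ : G.Adj u b) (h₂ : G.Adj b a)
    (h₃ : G.Adj a v) (hbv : b ≠ v) (hau : a ≠ u) (hb : c b ≠ none) (ha : c a ≠ none)
    (hab : c b ≠ c a) :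
    ∃ p : G.Path u v, (p : G.Walk u v).support = u :: ([b, a] ++ [v]) ∧
      (p : G.Walk u v).IsVertexProper c := by
  refine ⟨⟨.cons h₁ (.cons h₂ (.cons h₃ .nil)), ?_⟩, by simp, ?_, ?_⟩
  · simp [h₁.ne, h₂.ne, h₃.ne, huv, hbv, hau.symm]
  · intro x hx hxu hxv
    simp only [Walk.support_cons, Walk.support_nil, List.mem_cons, List.not_mem_nil, or_false]
      at hx
    obtain rfl | rfl : x = b ∨ x = a := by tauto
    · exact hb
    · exact ha
  · intro x y hxy hxu hxv hyu hyv
    simp only [Walk.edges_cons, Walk.edges_nil, List.mem_cons, List.not_mem_nil, or_false,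
      Sym2.eq_iff] at hxy
    obtain ⟨rfl, rfl⟩ | ⟨rfl, rfl⟩ : (x = b ∧ y = a) ∨ (x = a ∧ y = b) := by tauto
    · exact hab
    · exact hab.symm

/-- Compare a family of paths with a set `S` of internal vertices on which all occurring colours
agree and which contains no common neighbour of the end vertices: every path other than the edge
`u v` leaves `S` at an internal vertex, and the edge can be charged to `u`. -/
theorem card_add_lt_of_path_family [Fintype V] [DecidableEq V] {k : ℕ} (huv : u ≠ v)
    (P : Fin k → G.Path u v) (hinj : Function.Injective P)
    (hprop : ∀ i, (P i : G.Walk u v).IsVertexProper c)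
    (hdisj : ∀ i j, i ≠ j → ∀ w, w ∈ (P i : G.Walk u v).support →
      w ∈ (P j : G.Walk u v).support → w = u ∨ w = v)
    (S : Finset V) (hv : v ∉ S)
    (hS : ∀ w ∈ S, ¬ (G.Adj u w ∧ G.Adj w v))
    (hcol : ∀ a ∈ S, ∀ b ∈ S, c a ≠ none → c b ≠ none → c a = c b) (hu : u ∉ S) :
    S.card + k < Fintype.card V := by
  have key : ∀ p : G.Path u v, (p : G.Walk u v).IsVertexProper c →
      ∃ z ∈ (p : G.Walk u v).support, z ∉ insert v S ∧
        (z = u → (p : G.Walk u v).support = [u, v]) := by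
    rintro ⟨p, hp⟩ ⟨hc₁, hc₂⟩
    simp only at hc₁ hc₂ ⊢
    cases p with
    | nil => exact absurd rfl huv
    | @cons _ w _ h q =>
      cases q with
      | nil => exact ⟨u, by simp, by simp [huv, hu], by simp⟩
      | @cons _ w' _ h' q' =>
        rw [Walk.cons_isPath_iff, Walk.cons_isPath_iff] at hp
        obtain ⟨⟨hq', hw⟩, hu'⟩ := hp
        have hwv : w ≠ v := fun h => hw (h ▸ q'.end_mem_support)
        have hwu : w ≠ u := h.ne'
        by_cases hwS : w ∈ S
        · by_cases hw'S : w' ∈ S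
          · exfalso
            have hw'u : w' ≠ u := fun h => hu (h ▸ hw'S)
            have hw'v : w' ≠ v := fun h => hv (h ▸ hw'S)
            refine hc₂ w w' (by simp) hwu hwv hw'u hw'v (hcol _ hwS _ hw'S ?_ ?_)
            · exact hc₁ _ (by simp) hwu hwv
            · exact hc₁ _ (by simp) hw'u hw'v
          · refine ⟨w', by simp, ?_, ?_⟩
            · rw [Finset.mem_insert, not_or]
              refine ⟨?_, hw'S⟩
              rintro rfl
              exact hS w hwS ⟨h, h'⟩
            · rintro rfl
              exact absurd (by simp) hu'
        · exact ⟨w, by simp, by simp [hwv, hwS], fun h => absurd h hwu⟩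
  -- Charging the edge to `u` is unambiguous, since it can occur only once in the family.
  choose f hf₁ hf₂ hf₃ using fun i => key (P i) (hprop i)
  have hfinj : Function.Injective f := by
    intro i j hij
    by_contra hne
    rcases hdisj i j hne (f i) (hf₁ i) (hij ▸ hf₁ j) with h | h
    · apply hne
      apply hinj
      apply Subtype.ext
      apply Walk.ext_support
      rw [hf₃ i h, hf₃ j (hij ▸ h)]
    · exact hf₂ i (by simp [h])
  have hcard : (Finset.univ.image f).card = k := by
    rw [Finset.card_image_of_injective _ hfinj, Finset.card_univ, Fintype.card_fin]
  have hd : Disjoint (insert v S) (Finset.univ.image f) := by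
    rw [Finset.disjoint_right]
    intro z hz
    obtain ⟨i, -, rfl⟩ := Finset.mem_image.1 hz
    exact hf₂ i
  have := Finset.card_le_univ (insert v S ∪ Finset.univ.image f)
  rw [Finset.card_union_of_disjoint hd, hcard, Finset.card_insert_of_notMem hv] at this
  omega

end Families

/-! ### Matchings between differently coloured vertices -/

section Matching

/-- A matching between differently coloured elements of two finite sets, in the deficiency form of
Hall's theorem: the map is total on `A`, but up to `D` elements may be sent to dummies. A set of
elements of `A` with at least two colours sees all of `B`, so that only the monochromatic sets
impose a condition, besides the one on the cardinalities. -/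
theorem exists_matching_of_colours {V K : Type*} [DecidableEq V] [DecidableEq K] (c : V → K)
    (A B : Finset V) (D : ℕ) (hAB : A.card ≤ B.card + D)
    (hc : ∀ x, (A.filter (c · = x)).card + (B.filter (c · = x)).card ≤ B.card + D) :
    ∃ f : A → V ⊕ Fin D, Function.Injective f ∧
      ∀ a b, f a = Sum.inl b → b ∈ B ∧ c b ≠ c a := by
  let T : A → Finset (V ⊕ Fin D) := fun a => (B.filter (c · ≠ c a)).disjSum Finset.univ
  have hall : ∀ s : Finset A, s.card ≤ (s.biUnion T).card := by
    intro s
    rcases s.eq_empty_or_nonempty with rfl | ⟨a, ha⟩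
    · simp
    by_cases hmono : ∀ a' ∈ s, c a' = c a
    · have h₁ : s.card ≤ (A.filter (c · = c a)).card := by
        refine Finset.card_le_card_of_injOn (fun a => (a : V)) ?_ Subtype.val_injective.injOn
        intro a' ha'
        simpa using hmono a' ha'
      have h₂ : (T a).card ≤ (s.biUnion T).card :=
        Finset.card_le_card (Finset.subset_biUnion_of_mem T ha)
      have h₃ : (T a).card = (B.filter (c · ≠ c a)).card + D := by
        simp [T, Finset.card_disjSum]
      have h₄ := Finset.card_filter_add_card_filter_not (s := B) (c · = c a)
      have := hc (c a)
      simp only [ne_eq] at h₃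
      omega
    · push Not at hmono
      obtain ⟨a', ha', hne⟩ := hmono
      have h₁ : s.card ≤ A.card := by
        simpa using Finset.card_le_univ s
      have h₂ : B.disjSum (Finset.univ : Finset (Fin D)) ⊆ s.biUnion T := by
        intro z hz
        rw [Finset.mem_biUnion]
        rcases z with b | d
        · have hb : b ∈ B := by simpa using hz
          by_cases hba : c b = c a
          · exact ⟨a', ha', by simpa [T, hb, hba] using hne.symm⟩
          · exact ⟨a, ha, by simpa [T, hb] using hba⟩
        · exact ⟨a, ha, by simp [T]⟩
      have h₃ := Finset.card_le_card h₂
      rw [Finset.card_disjSum, Finset.card_univ, Fintype.card_fin] at h₃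
      omega
  obtain ⟨f, hf, hfT⟩ := (Finset.all_card_le_biUnion_card_iff_exists_injective T).1 hall
  refine ⟨f, hf, fun a b hab => ?_⟩
  have := hfT a
  rw [hab] at this
  simpa [T] using this

end Matching

/-! ### Proper connection of complete multipartite graphs -/

section Multipartite

theorem completeMultipartiteGraph_adj {ι : Type*} {W : ι → Type*} {u v : Σ i, W i} :
    (completeMultipartiteGraph W).Adj u v ↔ u.1 ≠ v.1 := Iff.rfl

variable {ι : Type*} [Fintype ι] [DecidableEq ι] {W : ι → Type*} [∀ i, Fintype (W i)] {s k : ℕ}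

theorem card_add_eq_card (i : ι) :
    (Finset.univ.filter fun w : Σ i, W i => w.1 = i).card +
      (Finset.univ.filter fun w : Σ i, W i => w.1 ≠ i).card = Fintype.card (Σ i, W i) :=
  Finset.card_filter_add_card_filter_not (s := Finset.univ) (fun w : Σ i, W i => w.1 = i)

variable [∀ i, DecidableEq (W i)]

/-- The vertices `a ≠ w` of colour `x` in the class of `w`. -/
def classmates {K : Type*} [DecidableEq K] (c : (Σ i, W i) → K) (w : Σ i, W i) (x : K) :
    Finset (Σ i, W i) :=
  Finset.univ.filter fun a => a.1 = w.1 ∧ a ≠ w ∧ c a = x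

/-- Uncoloured vertices may be given an arbitrary colour `x₀`. -/
theorem IsProperVertexConnected.card_classmates_lt {c : (Σ i, W i) → Option (Fin s)}
    (h : (completeMultipartiteGraph W).IsProperVertexConnected k c) (x₀ : Fin s)
    {u v : Σ i, W i} (huv : u.1 ≠ v.1) (x : Fin s) :
    (classmates (fun w => (c w).getD x₀) u x).card +
      (classmates (fun w => (c w).getD x₀) v x).card + k < Fintype.card (Σ i, W i) := by
  have hne : u ≠ v := fun h => huv (h ▸ rfl)
  obtain ⟨P, hinj, hprop, hdisj⟩ := h u v hne
  have hd : Disjoint (classmates (fun w => (c w).getD x₀) u x)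
      (classmates (fun w => (c w).getD x₀) v x) := by
    rw [Finset.disjoint_left]
    intro a ha hb
    simp only [classmates, Finset.mem_filter, Finset.mem_univ, true_and] at ha hb
    exact huv (ha.1.symm.trans hb.1)
  rw [← Finset.card_union_of_disjoint hd]
  refine card_add_lt_of_path_family hne P hinj hprop hdisj _ ?_ ?_ ?_ ?_
  · simp [classmates, huv.symm]
  · intro w hw
    simp only [classmates, Finset.mem_union, Finset.mem_filter, Finset.mem_univ, true_and] at hw
    simp only [completeMultipartiteGraph_adj]
    rintro ⟨h₁, h₂⟩
    rcases hw with hw | hw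
    · exact h₁ hw.1.symm
    · exact h₂ hw.1
  · intro a ha b hb hca hcb
    simp only [classmates, Finset.mem_union, Finset.mem_filter, Finset.mem_univ, true_and]
      at ha hb
    obtain ⟨y, hy⟩ := Option.ne_none_iff_exists'.1 hca
    obtain ⟨z, hz⟩ := Option.ne_none_iff_exists'.1 hcb
    have h₁ : y = x := by simpa [hy] using (show (c a).getD x₀ = x by tauto)
    have h₂ : z = x := by simpa [hz] using (show (c b).getD x₀ = x by tauto)
    rw [hy, hz, h₁, h₂]
  · simp [classmates, huv]

theorem card_class_sdiff (w : Σ i, W i) :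
    (Finset.univ.filter fun a : Σ i, W i => a.1 = w.1 ∧ a ≠ w).card + 1 =
      (Finset.univ.filter fun a : Σ i, W i => a.1 = w.1).card := by
  have : (Finset.univ.filter fun a : Σ i, W i => a.1 = w.1 ∧ a ≠ w) =
      (Finset.univ.filter fun a : Σ i, W i => a.1 = w.1).erase w := by
    ext a; simp [and_comm]
  rw [this]
  exact Finset.card_erase_add_one (by simp)

/-- If the vertices `u`, `v` lie in one class, the paths of length two suffice. Otherwise take the
edge `u v`, the paths of length two, and a path of length three for each pair of differently
coloured vertices in a matching between the two classes. -/
theorem isProperVertexConnected_of_card_classmates_lt (c : (Σ i, W i) → Fin s)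
    (hk : ∀ i, (Finset.univ.filter fun w : Σ i, W i => w.1 = i).card + k ≤
      Fintype.card (Σ i, W i))
    (h : ∀ u v : Σ i, W i, u.1 ≠ v.1 → ∀ x,
      (classmates c u x).card + (classmates c v x).card + k < Fintype.card (Σ i, W i)) :
    (completeMultipartiteGraph W).IsProperVertexConnected k (fun w => some (c w)) := by
  intro u v huv
  by_cases hcl : u.1 = v.1
  · have hcard : k ≤ Fintype.card {w : Σ i, W i // w.1 ≠ u.1} := by
      rw [Fintype.card_subtype]
      have := card_add_eq_card (W := W) u.1
      have := hk u.1
      omega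
    refine exists_path_family hcard (fun w => [w.1]) ?_ ?_ ?_
    · intro a b hab
      simpa [Subtype.ext_iff] using hab
    · intro a b hab
      simpa [Subtype.ext_iff, eq_comm] using hab
    · intro w
      exact exists_path_length_two huv (Ne.symm w.2) (fun h => w.2 (h.trans hcl.symm)) (by simp)
  · let A := Finset.univ.filter fun a : Σ i, W i => a.1 = u.1 ∧ a ≠ u
    let B := Finset.univ.filter fun a : Σ i, W i => a.1 = v.1 ∧ a ≠ v
    let R := Finset.univ.filter fun a : Σ i, W i => a.1 ≠ u.1 ∧ a.1 ≠ v.1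
    have hA : A.card + 1 = _ := card_class_sdiff u
    have hB : B.card + 1 = _ := card_class_sdiff v
    have hR : R.card + (Finset.univ.filter fun w : Σ i, W i => w.1 = v.1).card =
        (Finset.univ.filter fun w : Σ i, W i => w.1 ≠ u.1).card := by
      rw [← Finset.card_union_of_disjoint]
      · congr 1
        ext a
        simp only [R, Finset.mem_union, Finset.mem_filter, Finset.mem_univ, true_and]
        constructor
        · rintro (h | h)
          · exact h.1
          · exact fun h' => hcl (h'.symm.trans h)
        · tauto
      · rw [Finset.disjoint_left]
        intro a ha hb
        simp only [R, Finset.mem_filter, Finset.mem_univ, true_and] at ha hb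
        exact ha.2 hb
    have hN := card_add_eq_card (W := W) u.1
    have hku := hk u.1
    have hkv := hk v.1
    -- The number of dummies for which the family below has at least `k` members.
    obtain ⟨D, hD⟩ : ∃ D, B.card + D + k + 1 = Fintype.card (Σ i, W i) :=
      ⟨Fintype.card (Σ i, W i) - (B.card + k + 1), by omega⟩
    obtain ⟨f, hfinj, hf⟩ := exists_matching_of_colours c A B D (by omega) (by
      intro x
      have := h u v hcl x
      have h₁ : A.filter (c · = x) = classmates c u x := by
        ext a; simp [A, classmates, and_assoc]
      have h₂ : B.filter (c · = x) = classmates c v x := by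
        ext a; simp [B, classmates, and_assoc]
      rw [h₁, h₂]
      omega)
    let A' := {a : A // ∃ b, f a = Sum.inl b}
    have hA' : A.card ≤ Fintype.card A' + D := by
      have h₁ : Fintype.card {a : A // ¬ ∃ b, f a = Sum.inl b} ≤ Fintype.card (Fin D) := by
        have : ∀ a : {a : A // ¬ ∃ b, f a = Sum.inl b}, ∃ d, f a = Sum.inr d := by
          rintro ⟨a, ha⟩
          rcases hfa : f a with b | d
          · exact absurd ⟨b, hfa⟩ ha
          · exact ⟨d, rfl⟩
        choose g hg using this
        refine Fintype.card_le_of_injective g fun a b hab => ?_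
        exact Subtype.ext (hfinj ((hg a).trans (hab ▸ (hg b).symm)))
      have h₂ := Fintype.card_subtype_compl (fun a : A => ∃ b, f a = Sum.inl b)
      have h₃ := Fintype.card_subtype_le (fun a : A => ∃ b, f a = Sum.inl b)
      rw [Fintype.card_coe] at h₂ h₃
      rw [Fintype.card_fin] at h₁
      change _ ≤ Fintype.card {a : A // ∃ b, f a = Sum.inl b} + D
      omega
    choose g hg using fun a : A' => a.2
    have hgB : ∀ a, (g a).1 = v.1 ∧ g a ≠ v ∧ c (g a) ≠ c a.1 := by
      intro a
      have := hf a.1 (g a) (hg a)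
      simpa [B, and_assoc] using this
    have hAm : ∀ a : A', (a.1 : Σ i, W i).1 = u.1 ∧ (a.1 : Σ i, W i) ≠ u := by
      intro a
      exact (Finset.mem_filter.1 a.1.2).2
    have hRm : ∀ r : R, (r : Σ i, W i).1 ≠ u.1 ∧ (r : Σ i, W i).1 ≠ v.1 := by
      intro r
      exact (Finset.mem_filter.1 r.2).2
    have hginj : ∀ a b, g a = g b → a = b := by
      intro a b hab
      exact Subtype.ext (hfinj ((hg a).trans (hab ▸ (hg b).symm)))
    have hcard : k ≤ Fintype.card (Option (R ⊕ A')) := by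
      rw [Fintype.card_option, Fintype.card_sum, Fintype.card_coe]
      omega
    have hra : ∀ (r : R) (a : A'), (r : Σ i, W i) ≠ a.1 :=
      fun r a h => (hRm r).1 (h ▸ (hAm a).1)
    have hrg : ∀ (r : R) (a : A'), (r : Σ i, W i) ≠ g a :=
      fun r a h => (hRm r).2 (h ▸ (hgB a).1)
    have hga : ∀ a b : A', g a ≠ (b.1 : Σ i, W i) :=
      fun a b h => hcl ((hAm b).1.symm.trans (h ▸ (hgB a).1))
    let l : Option (R ⊕ A') → List (Σ i, W i) := fun o => match o with
      | none => []
      | some (.inl r) => [r.1]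
      | some (.inr a) => [g a, a.1]
    have hdisj : ∀ i j, i ≠ j → (l i).Disjoint (l j) := by
      rintro (_ | r | a) (_ | r' | a') hij
      · simp [l]
      · simp [l]
      · simp [l]
      · simp [l]
      · have : (r : Σ i, W i) ≠ r' := fun h => hij (by rw [Subtype.ext h])
        simpa [l, eq_comm] using this
      · simp [l, hrg, hra]
      · simp [l]
      · simp [l, hrg, hra]
      · have hne : a ≠ a' := fun h => hij (by rw [h])
        have h₁ : (a.1 : Σ i, W i) ≠ a'.1 := fun h => hne (Subtype.ext (Subtype.ext h))
        have h₂ : g a ≠ g a' := fun h => hne (hginj _ _ h)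
        simp [l, h₁.symm, h₂.symm, hga, (hga _ _).symm]
    refine exists_path_family hcard l ?_ hdisj ?_
    · intro i j hij
      by_contra hne
      have hd := hdisj i j hne
      rw [← hij] at hd
      have := List.eq_nil_iff_forall_not_mem.2 fun x hx => hd hx hx
      rw [this] at hij
      rcases i with _ | r | a
      · rcases j with _ | r | a
        · exact hne rfl
        · simp [l] at hij
        · simp [l] at hij
      · simp [l] at this
      · simp [l] at this
    · rintro (_ | r | a)
      · exact exists_path_length_one hcl
      · exact exists_path_length_two huv (hRm r).1.symm (hRm r).2 (by simp)
      · refine exists_path_length_three huv ?_ ?_ ?_ (hgB a).2.1 (hAm a).2 (by simp) (by simp) ?_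
        · rw [completeMultipartiteGraph_adj, (hgB a).1]; exact hcl
        · rw [completeMultipartiteGraph_adj, (hgB a).1, (hAm a).1]; exact Ne.symm hcl
        · rw [completeMultipartiteGraph_adj, (hAm a).1]; exact hcl
        · simpa using (hgB a).2.2

end Multipartite

end SimpleGraph

/-! ### Colour loads -/

section Loads

/-- The number of vertices of colour `x` in the `i`-th class, where `c i a` is the colour of the
`a`-th vertex of that class. -/
def colourCount (n : ℕ → ℕ) (c : ℕ → ℕ → ℕ) (i x : ℕ) : ℕ :=
  ((Finset.range (n i)).filter fun a => c i a = x).card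

/-- The largest number of vertices of colour `x` that can remain in the `i`-th class after the
removal of one vertex. -/
def colourLoad (n : ℕ → ℕ) (c : ℕ → ℕ → ℕ) (i x : ℕ) : ℕ :=
  min (colourCount n c i x) (n i - 1)

/-- There is a colouring of the classes `1, …, t` with the colours `0, …, s - 1` such that no colour
has loads of sum `D` or more in two different classes. -/
def HasBalancedColouring (t : ℕ) (n : ℕ → ℕ) (D s : ℕ) : Prop :=
  ∃ c : ℕ → ℕ → ℕ, (∀ i, 1 ≤ i → i ≤ t → ∀ a < n i, c i a < s) ∧
    ∀ i j, 1 ≤ i → i < j → j ≤ t → ∀ x < s, colourLoad n c i x + colourLoad n c j x < D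

end Loads

/-! ### The criterion in terms of loads -/

section Criterion

open SimpleGraph

variable {t : ℕ} {n : ℕ → ℕ} {s : ℕ}

theorem card_filter_class_and (p : (Σ i : Fin t, Fin (n (i.val + 1))) → Prop) [DecidablePred p]
    (q : ℕ → Prop) [DecidablePred q] (i : Fin t) (h : ∀ a, p ⟨i, a⟩ ↔ q a.val) :
    (Finset.univ.filter fun w : Σ i : Fin t, Fin (n (i.val + 1)) => w.1 = i ∧ p w).card =
      ((Finset.range (n (i.val + 1))).filter q).card := by
  symm
  refine Finset.card_bij
    (fun a ha => ⟨i, ⟨a, Finset.mem_range.1 (Finset.mem_filter.1 ha).1⟩⟩) ?_ ?_ ?_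
  · intro a ha
    simpa [h] using (Finset.mem_filter.1 ha).2
  · intro a ha b hb hab
    simpa using hab
  · rintro ⟨j, a⟩ hw
    simp only [Finset.mem_filter, Finset.mem_univ, true_and] at hw
    obtain ⟨rfl, hp⟩ := hw
    exact ⟨a, by simpa using (h a).1 hp, rfl⟩

theorem card_filter_class (i : Fin t) :
    (Finset.univ.filter fun w : Σ i : Fin t, Fin (n (i.val + 1)) => w.1 = i).card =
      n (i.val + 1) := by
  have := card_filter_class_and (n := n) (fun _ => True) (fun _ => True) i (by simp)
  simpa using this

theorem card_vertices (ht : 1 ≤ t) :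
    Fintype.card (Σ i : Fin t, Fin (n (i.val + 1))) = (∑ i ∈ Finset.Icc 1 (t - 1), n i) + n t := by
  obtain ⟨r, rfl⟩ : ∃ r, t = r + 1 := ⟨t - 1, by omega⟩
  rw [Fintype.card_sigma]
  simp only [Fintype.card_fin]
  rw [Fin.sum_univ_eq_sum_range (fun i => n (i + 1)) (r + 1), Finset.sum_range_succ,
    Nat.add_sub_cancel, Finset.range_eq_Ico, Finset.sum_Ico_add' n 0 r 1]
  rfl

variable {c : (Σ i : Fin t, Fin (n (i.val + 1))) → Fin s} {C : ℕ → ℕ → ℕ}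

theorem card_filter_colour (hC : ∀ w, (c w : ℕ) = C (w.1.val + 1) w.2.val) (i : Fin t)
    (x : Fin s) :
    (Finset.univ.filter fun w : Σ i : Fin t, Fin (n (i.val + 1)) => w.1 = i ∧ c w = x).card =
      colourCount n C (i.val + 1) x :=
  card_filter_class_and _ _ i fun a => by rw [← Fin.val_inj, hC]

theorem card_classmates_le_colourLoad (hC : ∀ w, (c w : ℕ) = C (w.1.val + 1) w.2.val)
    (w : Σ i : Fin t, Fin (n (i.val + 1))) (x : Fin s) :
    (classmates c w x).card ≤ colourLoad n C (w.1.val + 1) x := by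
  refine le_min ?_ ?_
  · rw [← card_filter_colour hC]
    refine Finset.card_le_card fun a => ?_
    simp only [classmates, Finset.mem_filter, Finset.mem_univ, true_and]
    tauto
  · have h := card_class_sdiff w
    rw [card_filter_class] at h
    refine (Finset.card_le_card fun a => ?_).trans (Nat.le_sub_of_add_le h.le)
    simp only [classmates, Finset.mem_filter, Finset.mem_univ, true_and]
    tauto

theorem exists_colourLoad_le_card_classmates
    (hC : ∀ w, (c w : ℕ) = C (w.1.val + 1) w.2.val) (i : Fin t) (hi : 1 ≤ n (i.val + 1))
    (x : Fin s) :
    ∃ w : Σ i : Fin t, Fin (n (i.val + 1)), w.1 = i ∧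
      colourLoad n C (i.val + 1) x ≤ (classmates c w x).card := by
  by_cases hx : ∃ w, w.1 = i ∧ c w ≠ x
  · obtain ⟨w, rfl, hw⟩ := hx
    refine ⟨w, rfl, (min_le_left _ _).trans ?_⟩
    rw [← card_filter_colour hC]
    refine Finset.card_le_card fun a => ?_
    simp only [classmates, Finset.mem_filter, Finset.mem_univ, true_and]
    rintro ⟨h₁, h₂⟩
    exact ⟨h₁, fun h => hw (h ▸ h₂), h₂⟩
  · push Not at hx
    refine ⟨⟨i, ⟨0, hi⟩⟩, rfl, (min_le_right _ _).trans ?_⟩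
    have h := card_class_sdiff (W := fun i : Fin t => Fin (n (i.val + 1))) ⟨i, ⟨0, hi⟩⟩
    rw [card_filter_class] at h
    refine (Nat.sub_le_iff_le_add.2 h.ge).trans ?_
    refine Finset.card_le_card fun a => ?_
    simp only [classmates, Finset.mem_filter, Finset.mem_univ, true_and]
    rintro ⟨h₁, h₂⟩
    exact ⟨h₁, h₂, hx a h₁⟩

/-- Proper vertex `k`-connection with `s ≥ 1` colours only depends on the colour loads of the
classes. -/
theorem exists_isProperVertexConnected_iff (ht : 1 ≤ t) (hpos : ∀ i, 1 ≤ i → i ≤ t → 1 ≤ n i)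
    (hle : ∀ i, 1 ≤ i → i ≤ t → n i ≤ n t) {k d : ℕ}
    (hkd : k + d = ∑ i ∈ Finset.Icc 1 (t - 1), n i) (hs : 1 ≤ s) :
    (∃ c : (Σ i : Fin t, Fin (n (i.val + 1))) → Option (Fin s),
      (completeMultipartite t n).IsProperVertexConnected k c) ↔
      HasBalancedColouring t n (n t + d) s := by
  have hcard := card_vertices (n := n) ht
  constructor
  · rintro ⟨c, hc⟩
    let x₀ : Fin s := ⟨0, hs⟩
    let C : ℕ → ℕ → ℕ := fun i a =>
      if h : ∃ hi : i - 1 < t, a < n (i - 1 + 1) then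
        ((c ⟨⟨i - 1, h.1⟩, ⟨a, h.2⟩⟩).getD x₀ : Fin s) else 0
    have hC : ∀ w : Σ i : Fin t, Fin (n (i.val + 1)),
        (((c w).getD x₀ : Fin s) : ℕ) = C (w.1.val + 1) w.2.val := by
      rintro ⟨i, a⟩
      simp only [C, Nat.add_sub_cancel]
      rw [dif_pos ⟨i.2, a.2⟩]
      rfl
    refine ⟨C, ?_, ?_⟩
    · intro i _ _ a _
      simp only [C]
      split_ifs
      · exact Fin.is_lt _
      · exact hs
    · intro i j hi hij hj x hx
      obtain ⟨u, hu, hu'⟩ := exists_colourLoad_le_card_classmates hC ⟨i - 1, by omega⟩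
        (hpos _ (by simp) (by simp; omega)) ⟨x, hx⟩
      obtain ⟨v, hv, hv'⟩ := exists_colourLoad_le_card_classmates hC ⟨j - 1, by omega⟩
        (hpos _ (by simp) (by simp; omega)) ⟨x, hx⟩
      have huv : u.1 ≠ v.1 := by
        rw [hu, hv, Ne, Fin.mk.injEq]
        omega
      have := IsProperVertexConnected.card_classmates_lt hc x₀ huv ⟨x, hx⟩
      simp only [Nat.sub_add_cancel hi, Nat.sub_add_cancel (hi.trans hij.le)] at hu' hv'
      omega
  · rintro ⟨C, hC, hD⟩
    let c : (Σ i : Fin t, Fin (n (i.val + 1))) → Fin s := fun w =>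
      ⟨C (w.1.val + 1) w.2.val, hC _ (by omega) (by omega) _ w.2.isLt⟩
    have hc : ∀ w, (c w : ℕ) = C (w.1.val + 1) w.2.val := fun _ => rfl
    refine ⟨fun w => some (c w), isProperVertexConnected_of_card_classmates_lt c ?_ ?_⟩
    · intro i
      rw [card_filter_class]
      have := hle (i.val + 1) (by omega) (by omega)
      omega
    · intro u v huv x
      have h₁ := card_classmates_le_colourLoad hc u x
      have h₂ := card_classmates_le_colourLoad hc v x
      have huv' : u.1.val ≠ v.1.val := fun h => huv (Fin.ext h)
      rcases Nat.lt_or_gt_of_ne huv' with h | h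
      · have := hD (u.1.val + 1) (v.1.val + 1) (by omega) (by omega) (by omega) x x.2
        omega
      · have := hD (v.1.val + 1) (u.1.val + 1) (by omega) (by omega) (by omega) x x.2
        omega

/-- Without colours only adjacent vertices are joined by vertex-proper paths. -/
theorem not_isProperVertexConnected_zero (ht : 1 ≤ t) (hnt : 2 ≤ n t) {k : ℕ} (hk : 1 ≤ k)
    (c : (Σ i : Fin t, Fin (n (i.val + 1))) → Option (Fin 0)) :
    ¬ (completeMultipartite t n).IsProperVertexConnected k c := by
  intro h
  have ht' : t - 1 + 1 = t := Nat.sub_add_cancel ht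
  let u : Σ i : Fin t, Fin (n (i.val + 1)) := ⟨⟨t - 1, by omega⟩, ⟨0, by simp only [ht']; omega⟩⟩
  let v : Σ i : Fin t, Fin (n (i.val + 1)) := ⟨⟨t - 1, by omega⟩, ⟨1, by simp only [ht']; omega⟩⟩
  have huv : u ≠ v := by simp [u, v]
  have hcl : u.1 = v.1 := rfl
  clear_value u v
  obtain ⟨P, -, hP, -⟩ := h u v huv
  have hp := hP ⟨0, hk⟩
  generalize P ⟨0, hk⟩ = p at hp
  obtain ⟨p, hpath⟩ := p
  obtain ⟨hp, -⟩ := hp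
  simp only at hp
  cases p with
  | nil => exact huv rfl
  | @cons _ w _ hw q =>
    have hwu : w.1 ≠ u.1 := fun h => hw h.symm
    refine hp w (by simp) (fun h => hwu (h ▸ rfl)) (fun h => hwu (h ▸ hcl.symm)) ?_
    rcases c w with _ | x
    · rfl
    · exact x.elim0

theorem SimpleGraph.IsProperVertexConnected.castLE {V : Type*} {G : SimpleGraph V} {k r s : ℕ}
    {c : V → Option (Fin r)} (h : G.IsProperVertexConnected k c) (hrs : r ≤ s) :
    G.IsProperVertexConnected k fun w => (c w).map (Fin.castLE hrs) := by
  intro u v huv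
  obtain ⟨P, hinj, hP, hdisj⟩ := h u v huv
  refine ⟨P, hinj, fun i => ⟨fun a ha hau hav => ?_, fun a b hab h₁ h₂ h₃ h₄ heq => ?_⟩, hdisj⟩
  · simpa using (hP i).1 a ha hau hav
  · exact (hP i).2 a b hab h₁ h₂ h₃ h₄
      (Option.map_injective (Fin.castLE_injective hrs) heq)

theorem pvc_eq_of_hasBalancedColouring (ht : 1 ≤ t) (hpos : ∀ i, 1 ≤ i → i ≤ t → 1 ≤ n i)
    (hle : ∀ i, 1 ≤ i → i ≤ t → n i ≤ n t) (hnt : 2 ≤ n t) {k d : ℕ} (hk : 1 ≤ k)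
    (hkd : k + d = ∑ i ∈ Finset.Icc 1 (t - 1), n i) {r : ℕ}
    (hbal : HasBalancedColouring t n (n t + d) (r + 1))
    (hnot : 1 ≤ r → ¬ HasBalancedColouring t n (n t + d) r) :
    (completeMultipartite t n).pvc k = r + 1 := by
  have hmem := (exists_isProperVertexConnected_iff ht hpos hle hkd (Nat.le_add_left 1 r)).2 hbal
  refine le_antisymm (Nat.sInf_le hmem) ?_
  refine le_csInf ⟨_, hmem⟩ ?_
  rintro q ⟨c, hc⟩
  by_contra! hq
  have hc' := hc.castLE (Nat.le_of_lt_succ hq)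
  rcases Nat.eq_zero_or_pos r with rfl | hr
  · exact not_isProperVertexConnected_zero ht hnt hk _ hc'
  · exact hnot hr ((exists_isProperVertexConnected_iff ht hpos hle hkd hr).1 ⟨_, hc'⟩)

end Criterion

/-! ### Counting colours -/

section Counting

theorem colourLoad_le_colourCount (n : ℕ → ℕ) (c : ℕ → ℕ → ℕ) (i x : ℕ) :
    colourLoad n c i x ≤ colourCount n c i x := min_le_left _ _

theorem colourLoad_le_sub_one (n : ℕ → ℕ) (c : ℕ → ℕ → ℕ) (i x : ℕ) :
    colourLoad n c i x ≤ n i - 1 := min_le_right _ _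

theorem sum_colourCount {n : ℕ → ℕ} {c : ℕ → ℕ → ℕ} {i s : ℕ} (h : ∀ a < n i, c i a < s) :
    ∑ x ∈ Finset.range s, colourCount n c i x = n i := by
  have := Finset.card_eq_sum_card_fiberwise (s := Finset.range (n i)) (t := Finset.range s)
    (f := c i) (fun a ha => by simpa using h a (by simpa using ha))
  simpa [colourCount] using this.symm

theorem card_filter_mod_two (e x n : ℕ) (hx : x < 2) :
    ((Finset.range n).filter fun a => (a + e) % 2 = x).card =
      if e % 2 = x then (n + 1) / 2 else n / 2 := by
  induction n with
  | zero => simp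
  | succ n ih =>
    rw [Finset.range_add_one, Finset.filter_insert]
    split_ifs at ih ⊢ <;> simp_all <;> omega

theorem card_filter_mod_three (e x n : ℕ) (hx : x < 3) :
    ((Finset.range n).filter fun a => (a + e) % 3 = x).card =
      if e % 3 = x then (n + 2) / 3 else if (e + 1) % 3 = x then (n + 1) / 3 else n / 3 := by
  induction n with
  | zero => simp
  | succ n ih =>
    rw [Finset.range_add_one, Finset.filter_insert]
    split_ifs at ih ⊢ <;> simp_all <;> omega

/-- The colours `0` and `1` alternate in each class, starting with the parity of `e i`. -/
theorem colourCount_mod_two (n e : ℕ → ℕ) (i x : ℕ) (hx : x < 2) :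
    colourCount n (fun i a => (a + e i) % 2) i x =
      if e i % 2 = x then (n i + 1) / 2 else n i / 2 :=
  card_filter_mod_two _ _ _ hx

theorem colourCount_mod_three (n e : ℕ → ℕ) (i x : ℕ) (hx : x < 3) :
    colourCount n (fun i a => (a + e i) % 3) i x =
      if e i % 3 = x then (n i + 2) / 3 else if (e i + 1) % 3 = x then (n i + 1) / 3
        else n i / 3 :=
  card_filter_mod_three _ _ _ hx

theorem colourCount_eq_of_forall {n : ℕ → ℕ} {c : ℕ → ℕ → ℕ} {i x : ℕ} (h : ∀ a < n i, c i a = x) :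
    colourCount n c i x = n i := by
  rw [colourCount, Finset.filter_true_of_mem (by simpa using h), Finset.card_range]

theorem colourCount_eq_zero {n : ℕ → ℕ} {c : ℕ → ℕ → ℕ} {i x : ℕ} (h : ∀ a < n i, c i a ≠ x) :
    colourCount n c i x = 0 := by
  rw [colourCount, Finset.filter_false_of_mem (by simpa using h), Finset.card_empty]

theorem one_le_colourCount {n : ℕ → ℕ} {c : ℕ → ℕ → ℕ} {i a : ℕ} (ha : a < n i) :
    1 ≤ colourCount n c i (c i a) :=
  Finset.card_pos.2 ⟨a, by simpa using ha⟩

end Counting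

/-! ### Existence and non-existence of balanced colourings -/

section Balanced

variable {t : ℕ} {n : ℕ → ℕ} {D : ℕ}

theorem hasBalancedColouring_one (hmono : ∀ i j, 1 ≤ i → i ≤ j → j ≤ t → n i ≤ n j)
    (h : n t - 1 + (n (t - 1) - 1) < D) : HasBalancedColouring t n D 1 := by
  refine ⟨fun _ _ => 0, by simp, fun i j hi hij hj x _ => ?_⟩
  have h₁ := colourLoad_le_sub_one n (fun _ _ => 0) i x
  have h₂ := colourLoad_le_sub_one n (fun _ _ => 0) j x
  have h₃ := hmono i (t - 1) hi (by omega) (by omega)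
  have h₄ := hmono j t (by omega) hj le_rfl
  omega

theorem not_hasBalancedColouring_one (ht : 2 ≤ t) (h : D ≤ n t - 1 + (n (t - 1) - 1)) :
    ¬ HasBalancedColouring t n D 1 := by
  rintro ⟨c, hc, hD⟩
  have key : ∀ i, 1 ≤ i → i ≤ t → colourLoad n c i 0 = n i - 1 := by
    intro i hi hit
    rw [colourLoad, colourCount_eq_of_forall fun a ha => by have := hc i hi hit a ha; omega]
    omega
  have := hD (t - 1) t (by omega) (by omega) le_rfl 0 one_pos
  rw [key _ (by omega) (by omega), key _ (by omega) le_rfl] at this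
  omega

theorem colourCount_zero_add_one {c : ℕ → ℕ → ℕ} {i : ℕ} (h : ∀ a < n i, c i a < 2) :
    colourCount n c i 0 + colourCount n c i 1 = n i := by
  simpa [Finset.sum_range_succ] using sum_colourCount h

/-- Splitting every class into halves. -/
theorem hasBalancedColouring_two_of_le (hle : ∀ i, 1 ≤ i → i ≤ t → n i ≤ n t)
    (hD : n t + 2 ≤ D) : HasBalancedColouring t n D 2 := by
  refine ⟨fun i a => (a + 0) % 2, fun _ _ _ _ _ => Nat.mod_lt _ two_pos,
    fun i j hi hij hj x hx => ?_⟩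
  refine (add_le_add (colourLoad_le_colourCount _ _ _ _)
    (colourLoad_le_colourCount _ _ _ _)).trans_lt ?_
  rw [colourCount_mod_two n (fun _ => 0) i x hx, colourCount_mod_two n (fun _ => 0) j x hx]
  have h₁ := hle i hi (by omega)
  have h₂ := hle j (by omega) hj
  split_ifs <;> omega

/-- Splitting into halves, where the `(t - 1)`-st class gets its majority in the colour that is in
the minority in the `t`-th class. -/
theorem hasBalancedColouring_two_succ (ht : 3 ≤ t)
    (hmono : ∀ i j, 1 ≤ i → i ≤ j → j ≤ t → n i ≤ n j)
    (h : ¬ (n t = n (t - 1) ∧ n (t - 1) = n (t - 2) ∧ Odd (n t))) :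
    HasBalancedColouring t n (n t + 1) 2 := by
  let e : ℕ → ℕ := fun i => if i = t - 1 then 1 else 0
  refine ⟨fun i a => (a + e i) % 2, fun _ _ _ _ _ => Nat.mod_lt _ two_pos,
    fun i j hi hij hj x hx => ?_⟩
  refine (add_le_add (colourLoad_le_colourCount _ _ _ _)
    (colourLoad_le_colourCount _ _ _ _)).trans_lt ?_
  rw [colourCount_mod_two n e i x hx, colourCount_mod_two n e j x hx]
  have h₁ := hmono i j hi hij.le hj
  have h₂ := hmono j t (by omega) hj le_rfl
  have h₃ := hmono (t - 1) t (by omega) (by omega) le_rfl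
  have h₄ := hmono (t - 2) (t - 1) (by omega) (by omega) (by omega)
  rw [Nat.odd_iff] at h
  have hit : i ≤ t - 1 := by omega
  rcases hit.eq_or_lt with rfl | hi'
  · obtain rfl : j = t := by omega
    have : e j = 0 := if_neg (by omega)
    have h' : e (j - 1) = 1 := if_pos rfl
    rw [this, h']
    split_ifs <;> omega
  · have h₅ := hmono i (t - 2) hi (by omega) (by omega)
    split_ifs <;> omega

/-- Of three classes of odd size `n t`, two have the same majority colour. -/
theorem not_hasBalancedColouring_two_of_odd (ht : 3 ≤ t) (h₁ : n t = n (t - 1))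
    (h₂ : n (t - 1) = n (t - 2)) (h₃ : 3 ≤ n t) (hodd : Odd (n t)) :
    ¬ HasBalancedColouring t n (n t + 1) 2 := by
  rintro ⟨c, hc, hD⟩
  have k₁ := colourCount_zero_add_one (hc t (by omega) le_rfl)
  have k₂ := colourCount_zero_add_one (hc (t - 1) (by omega) (by omega))
  have k₃ := colourCount_zero_add_one (hc (t - 2) (by omega) (by omega))
  have d₁ := hD (t - 2) (t - 1) (by omega) (by omega) (by omega)
  have d₂ := hD (t - 2) t (by omega) (by omega) (by omega)
  have d₃ := hD (t - 1) t (by omega) (by omega) (by omega)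
  have a₀ := d₁ 0 two_pos
  have a₁ := d₁ 1 one_lt_two
  have b₀ := d₂ 0 two_pos
  have b₁ := d₂ 1 one_lt_two
  have e₀ := d₃ 0 two_pos
  have e₁ := d₃ 1 one_lt_two
  simp only [colourLoad] at a₀ a₁ b₀ b₁ e₀ e₁
  rw [Nat.odd_iff] at hodd
  omega

/-- Splitting every class into thirds. -/
theorem hasBalancedColouring_three_of_le (hle : ∀ i, 1 ≤ i → i ≤ t → n i ≤ n t)
    (hD : 2 * ((n t + 2) / 3) < D) : HasBalancedColouring t n D 3 := by
  refine ⟨fun i a => (a + 0) % 3, fun _ _ _ _ _ => Nat.mod_lt _ three_pos,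
    fun i j hi hij hj x hx => ?_⟩
  refine (add_le_add (colourLoad_le_colourCount _ _ _ _)
    (colourLoad_le_colourCount _ _ _ _)).trans_lt ?_
  rw [colourCount_mod_three n (fun _ => 0) i x hx, colourCount_mod_three n (fun _ => 0) j x hx]
  have h₁ := hle i hi (by omega)
  have h₂ := hle j (by omega) hj
  split_ifs <;> omega

/-- Splitting into halves, where the majority colour of the `t`-th class is the minority colour of
all other classes. -/
theorem hasBalancedColouring_two_of_add_two_le
    (hmono : ∀ i j, 1 ≤ i → i ≤ j → j ≤ t → n i ≤ n j) (h : n (t - 1) + 2 ≤ n t) :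
    HasBalancedColouring t n (n t) 2 := by
  let e : ℕ → ℕ := fun i => if i = t then 1 else 0
  refine ⟨fun i a => (a + e i) % 2, fun _ _ _ _ _ => Nat.mod_lt _ two_pos,
    fun i j hi hij hj x hx => ?_⟩
  refine (add_le_add (colourLoad_le_colourCount _ _ _ _)
    (colourLoad_le_colourCount _ _ _ _)).trans_lt ?_
  rw [colourCount_mod_two n e i x hx, colourCount_mod_two n e j x hx]
  have h₁ := hmono i (t - 1) hi (by omega) (by omega)
  have hei : e i = 0 := if_neg (by omega)
  rcases hj.eq_or_lt with rfl | hj'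
  · have hej : e j = 1 := if_pos rfl
    rw [hei, hej]
    split_ifs <;> omega
  · have h₂ := hmono j (t - 1) (by omega) (by omega) (by omega)
    split_ifs <;> omega

/-- The `t`-th class gets the colour `1` and all other classes get the colour `0`: the load of a
monochromatic class is one less than its size. -/
theorem hasBalancedColouring_two_of_add_le (ht : 3 ≤ t) (hpos : ∀ i, 1 ≤ i → i ≤ t → 1 ≤ n i)
    (hmono : ∀ i j, 1 ≤ i → i ≤ j → j ≤ t → n i ≤ n j) (h : n (t - 1) + n (t - 2) ≤ n t + 1) :
    HasBalancedColouring t n (n t) 2 := by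
  refine ⟨fun i _ => if i = t then 1 else 0, fun i _ _ a _ => ?_, fun i j hi hij hj x hx => ?_⟩
  · dsimp only
    split_ifs <;> omega
  have hni := hmono i (t - 1) hi (by omega) (by omega)
  have hnt := hmono (t - 1) t (by omega) (by omega) le_rfl
  have hp := hpos (t - 1) (by omega) (by omega)
  have hi' := colourLoad_le_sub_one n (fun i _ => if i = t then 1 else 0) i x
  have hj' := colourLoad_le_sub_one n (fun i _ => if i = t then 1 else 0) j x
  rcases hj.eq_or_lt with rfl | hjt
  · obtain rfl | rfl : x = 0 ∨ x = 1 := by omega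
    · have : colourCount n (fun i _ => if i = j then 1 else 0) j 0 = 0 :=
        colourCount_eq_zero fun a _ => by simp
      have := (colourLoad_le_colourCount n _ j 0).trans this.le
      omega
    · have : colourCount n (fun i _ => if i = j then 1 else 0) i 1 = 0 :=
        colourCount_eq_zero fun a _ => by simp [hij.ne]
      have := (colourLoad_le_colourCount n _ i 1).trans this.le
      omega
  · have := hmono j (t - 1) (by omega) (by omega) (by omega)
    have := hmono i (t - 2) hi (by omega) (by omega)
    have := hpos (t - 2) (by omega) (by omega)
    omega

/-- With two colours, the `t`-th and the `(t - 1)`-st class are too large unless one of them is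
monochromatic; the loads of these two classes then leave no room for a third class. -/
theorem not_hasBalancedColouring_two (ht : 3 ≤ t)
    (h : (n (t - 1) + 1 = n t ∧ 3 ≤ n (t - 2) ∧ n (t - 2) ≤ n (t - 1)) ∨
      (n (t - 1) = n t ∧ 3 ≤ n t ∧ 2 ≤ n (t - 2))) :
    ¬ HasBalancedColouring t n (n t) 2 := by
  rintro ⟨c, hc, hD⟩
  have k₁ := colourCount_zero_add_one (hc t (by omega) le_rfl)
  have k₂ := colourCount_zero_add_one (hc (t - 1) (by omega) (by omega))
  have k₃ := colourCount_zero_add_one (hc (t - 2) (by omega) (by omega))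
  have d₁ := hD (t - 2) (t - 1) (by omega) (by omega) (by omega)
  have d₂ := hD (t - 2) t (by omega) (by omega) (by omega)
  have d₃ := hD (t - 1) t (by omega) (by omega) (by omega)
  have a₀ := d₁ 0 two_pos
  have a₁ := d₁ 1 one_lt_two
  have b₀ := d₂ 0 two_pos
  have b₁ := d₂ 1 one_lt_two
  have e₀ := d₃ 0 two_pos
  have e₁ := d₃ 1 one_lt_two
  simp only [colourLoad] at a₀ a₁ b₀ b₁ e₀ e₁
  omega

/-- Splitting into thirds, with the first colour rotating, so that among the classes of size four
only those whose indices are congruent modulo three have the same majority colour. -/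
theorem hasBalancedColouring_three (ht : 3 ≤ t)
    (hmono : ∀ i j, 1 ≤ i → i ≤ j → j ≤ t → n i ≤ n j) (h₃ : 3 ≤ n t)
    (h : ¬ (4 ≤ t ∧ n t = 4 ∧ n (t - 1) = 4 ∧ n (t - 2) = 4 ∧ n (t - 3) = 4)) :
    HasBalancedColouring t n (n t) 3 := by
  by_cases h₄ : n t = 4
  swap
  · exact hasBalancedColouring_three_of_le (fun i hi hit => hmono i t hi hit le_rfl) (by omega)
  refine ⟨fun i a => (a + i) % 3, fun _ _ _ _ _ => Nat.mod_lt _ three_pos,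
    fun i j hi hij hj x hx => ?_⟩
  refine (add_le_add (colourLoad_le_colourCount _ _ _ _)
    (colourLoad_le_colourCount _ _ _ _)).trans_lt ?_
  rw [colourCount_mod_three n (fun i => i) i x hx, colourCount_mod_three n (fun i => i) j x hx]
  have h₁ := hmono i j hi hij.le hj
  have h₂ := hmono j t (by omega) hj le_rfl
  by_cases hmod : i % 3 = j % 3
  · have k₃ := hmono i (t - 3) hi (by omega) (by omega)
    have k₂ := hmono (t - 3) (t - 2) (by omega) (by omega) (by omega)
    have k₁ := hmono (t - 2) (t - 1) (by omega) (by omega) (by omega)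
    have k₀ := hmono (t - 1) t (by omega) (by omega) (by omega)
    have : n i ≤ 3 := by omega
    split_ifs <;> omega
  · split_ifs <;> omega

/-- Each class of size four has a colour that occurs twice. -/
theorem not_hasBalancedColouring_three (ht : 4 ≤ t) (h₀ : n t = 4) (h₁ : n (t - 1) = 4)
    (h₂ : n (t - 2) = 4) (h₃ : n (t - 3) = 4) : ¬ HasBalancedColouring t n (n t) 3 := by
  rintro ⟨c, hc, hD⟩
  have key : ∀ r < 4, ∃ x < 3, 2 ≤ colourLoad n c (t - r) x := by
    intro r hr
    have hn : n (t - r) = 4 := by interval_cases r <;> simpa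
    have := sum_colourCount (hc (t - r) (by omega) (by omega))
    simp only [Finset.sum_range_succ, Finset.sum_range_zero] at this
    by_contra! hx
    have a₀ := hx 0 (by omega)
    have a₁ := hx 1 (by omega)
    have a₂ := hx 2 (by omega)
    simp only [colourLoad] at a₀ a₁ a₂
    omega
  choose! f hf hf' using key
  obtain ⟨a, ha, b, hb, hab, hfab⟩ := Finset.exists_ne_map_eq_of_card_lt_of_maps_to
    (s := Finset.range 4) (t := Finset.range 3) (by simp) (f := f)
    (fun r hr => by simpa using hf r (by simpa using hr))
  rw [Finset.mem_range] at ha hb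
  have l₁ := hf' a ha
  have l₂ := hf' b hb
  rw [← hfab] at l₂
  rcases Nat.lt_or_gt_of_ne hab with h | h
  · have := hD (t - b) (t - a) (by omega) (by omega) (by omega) (f a) (hf a ha)
    omega
  · have := hD (t - a) (t - b) (by omega) (by omega) (by omega) (f a) (hf a ha)
    omega

/-- A class of size at most `s` can be coloured injectively. -/
theorem hasBalancedColouring_of_le {s : ℕ} (hle : ∀ i, 1 ≤ i → i ≤ t → n i ≤ s) (hD : 3 ≤ D) :
    HasBalancedColouring t n D s := by
  refine ⟨fun _ a => a, fun i hi hit a ha => ha.trans_le (hle i hi hit),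
    fun i j _ _ _ x _ => ?_⟩
  have key : ∀ i, colourLoad n (fun _ a => a) i x ≤ 1 := fun i =>
    (colourLoad_le_colourCount n _ i x).trans <| Finset.card_le_one.2 fun a ha b hb =>
      (Finset.mem_filter.1 ha).2.trans (Finset.mem_filter.1 hb).2.symm
  have := key i
  have := key j
  omega

/-- Each class of size two gets a colour of its own. -/
theorem hasBalancedColouring_of_two {s : ℕ} (hs : 1 ≤ s)
    (h₂ : ∀ i, 1 ≤ i → i ≤ t → t < i + s → n i = 2)
    (h₁ : ∀ i, 1 ≤ i → i + s ≤ t → n i = 1) : HasBalancedColouring t n 2 s := by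
  refine ⟨fun i _ => if i + s ≤ t then 0 else t - i, fun i _ _ a _ => ?_,
    fun i j hi hij hj x _ => ?_⟩
  · dsimp only
    split_ifs <;> omega
  have hi' := colourLoad_le_sub_one n (fun i _ => if i + s ≤ t then 0 else t - i) i x
  have hj' := colourLoad_le_sub_one n (fun i _ => if i + s ≤ t then 0 else t - i) j x
  have hnj : n j ≤ 2 := by
    by_cases h : j + s ≤ t
    · rw [h₁ j (by omega) h]; omega
    · rw [h₂ j (by omega) hj (by omega)]
  by_cases his : i + s ≤ t
  · rw [h₁ i hi his] at hi'
    omega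
  · rw [h₂ i hi (by omega) (by omega)] at hi'
    have key : ∀ l, ¬ l + s ≤ t → t - l ≠ x →
        colourLoad n (fun i _ => if i + s ≤ t then 0 else t - i) l x = 0 := fun l hl hlx =>
      Nat.le_zero.1 <| (colourLoad_le_colourCount n _ l x).trans
        (colourCount_eq_zero fun a _ => by simpa [hl] using hlx).le
    by_cases hx : t - i = x
    · have := key j (by omega) (by omega)
      omega
    · have := key i his hx
      omega

/-- Different classes of size two have no colour in common. -/
theorem not_hasBalancedColouring_of_two {s r : ℕ} (hr : r < s) (hst : s ≤ t)
    (h₂ : ∀ i, 1 ≤ i → i ≤ t → t < i + s → n i = 2) : ¬ HasBalancedColouring t n 2 r := by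
  rintro ⟨c, hc, hD⟩
  have hn : ∀ a < s, n (t - a) = 2 := fun a ha => h₂ _ (by omega) (by omega) (by omega)
  have hlt : ∀ a < s, c (t - a) 0 < r := fun a ha =>
    hc _ (by omega) (by omega) 0 (by rw [hn a ha]; omega)
  have hload : ∀ a < s, 1 ≤ colourLoad n c (t - a) (c (t - a) 0) := fun a ha =>
    le_min (one_le_colourCount (by rw [hn a ha]; omega)) (by rw [hn a ha])
  obtain ⟨a, ha, b, hb, hab, hfab⟩ := Finset.exists_ne_map_eq_of_card_lt_of_maps_to
    (s := Finset.range s) (t := Finset.range r) (by simpa) (f := fun a => c (t - a) 0)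
    (fun a ha => by simpa using hlt a (by simpa using ha))
  rw [Finset.mem_range] at ha hb
  have l₁ := hload a ha
  have l₂ := hload b hb
  rw [← hfab] at l₂
  rcases Nat.lt_or_gt_of_ne hab with h | h
  · have := hD (t - b) (t - a) (by omega) (by omega) (by omega) _ (hlt a ha)
    omega
  · have := hD (t - a) (t - b) (by omega) (by omega) (by omega) _ (hlt a ha)
    omega

end Balanced

/-! ### The values of the proper vertex connection numbers -/

theorem theorem4 (t : ℕ) (n : ℕ → ℕ) (m : ℕ) (ht : 3 ≤ t)
    (hpos : ∀ i, 1 ≤ i → i ≤ t → 1 ≤ n i)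
    (hmono : ∀ i j, 1 ≤ i → i ≤ j → j ≤ t → n i ≤ n j)
    (hnt : 2 ≤ n t)
    (hm : m = ∑ i ∈ Finset.Icc 1 (t - 1), n i) :
    (∀ k, 1 ≤ k → k + 2 ≤ m →
      (k + n (t - 1) ≤ m + 1 → (completeMultipartite t n).pvc k = 1) ∧
      (m + 2 ≤ k + n (t - 1) → (completeMultipartite t n).pvc k = 2)) ∧
    ((n (t - 1) ≤ 2 → (completeMultipartite t n).pvc (m - 1) = 1) ∧
      (3 ≤ n (t - 1) → ¬ (n t = n (t - 1) ∧ n (t - 1) = n (t - 2) ∧ Odd (n t)) →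
        (completeMultipartite t n).pvc (m - 1) = 2) ∧
      (n t = n (t - 1) → n (t - 1) = n (t - 2) → 3 ≤ n t → Odd (n t) →
        (completeMultipartite t n).pvc (m - 1) = 3)) ∧
    ((n (t - 1) = 1 → (completeMultipartite t n).pvc m = 1) ∧
      (2 ≤ n (t - 1) → n (t - 1) + 2 ≤ n t → (completeMultipartite t n).pvc m = 2) ∧
      ((n (t - 1) + 1 = n t ∧ 2 ≤ n (t - 1) ∧ n (t - 2) ≤ 2) ∨
          (n (t - 1) = n t ∧ 2 ≤ n t ∧ n (t - 2) = 1) →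
        (completeMultipartite t n).pvc m = 2) ∧
      ((n (t - 1) + 1 = n t ∧ 3 ≤ n (t - 2)) ∨
          (n (t - 1) = n t ∧ 3 ≤ n t ∧ 2 ≤ n (t - 2)) →
        ¬ (4 ≤ t ∧ n t = 4 ∧ n (t - 1) = 4 ∧ n (t - 2) = 4 ∧ n (t - 3) = 4) →
        (completeMultipartite t n).pvc m = 3) ∧
      (4 ≤ t → n t = 4 → n (t - 1) = 4 → n (t - 2) = 4 → n (t - 3) = 4 →
        (completeMultipartite t n).pvc m = 4) ∧
      (∀ s, 1 ≤ s → s ≤ t →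
        (∀ i, 1 ≤ i → i ≤ t → t < i + s → n i = 2) →
        (∀ i, 1 ≤ i → i + s ≤ t → n i = 1) →
        (completeMultipartite t n).pvc m = s)) := by
  have hle : ∀ i, 1 ≤ i → i ≤ t → n i ≤ n t := fun i hi hit => hmono i t hi hit le_rfl
  have hpvc : ∀ k d r, 1 ≤ k → k + d = m → HasBalancedColouring t n (n t + d) (r + 1) →
      (1 ≤ r → ¬ HasBalancedColouring t n (n t + d) r) →
      (completeMultipartite t n).pvc k = r + 1 := fun k d r hk hkd h h' =>
    pvc_eq_of_hasBalancedColouring (by omega) hpos hle hnt hk (hkd.trans hm) h h'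
  have hm2 : n (t - 1) + 1 ≤ m := by
    have hsub : ({t - 2, t - 1} : Finset ℕ) ⊆ Finset.Icc 1 (t - 1) := by
      intro i hi
      simp only [Finset.mem_insert, Finset.mem_singleton, Finset.mem_Icc] at hi ⊢
      omega
    have h := Finset.sum_le_sum_of_subset (f := n) hsub
    rw [Finset.sum_pair (by omega), ← hm] at h
    have := hpos (t - 2) (by omega) (by omega)
    omega
  have h₀ := hpos (t - 2) (by omega) (by omega)
  have h₁ := hmono (t - 2) (t - 1) (by omega) (by omega) (by omega)
  have h₂ := hle (t - 1) (by omega) (by omega)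
  refine ⟨fun k hk hkm => ⟨fun h => ?_, fun h => ?_⟩, ⟨fun h => ?_, fun h h' => ?_,
    fun h h' h'' hodd => ?_⟩, fun h => ?_, fun h h' => ?_, fun h => ?_, fun h h' => ?_,
    fun h a b c d => ?_, fun s hs hst h h' => ?_⟩
  · exact hpvc k (m - k) 0 hk (by omega) (hasBalancedColouring_one hmono (by omega)) (by omega)
  · exact hpvc k (m - k) 1 hk (by omega) (hasBalancedColouring_two_of_le hle (by omega))
      fun _ => not_hasBalancedColouring_one (by omega) (by omega)
  · exact hpvc (m - 1) 1 0 (by omega) (by omega) (hasBalancedColouring_one hmono (by omega))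
      (by omega)
  · exact hpvc (m - 1) 1 1 (by omega) (by omega) (hasBalancedColouring_two_succ ht hmono h')
      fun _ => not_hasBalancedColouring_one (by omega) (by omega)
  · exact hpvc (m - 1) 1 2 (by omega) (by omega)
      (hasBalancedColouring_three_of_le hle (by omega))
      fun _ => not_hasBalancedColouring_two_of_odd ht h h' h'' hodd
  · exact hpvc m 0 0 (by omega) rfl (hasBalancedColouring_one hmono (by omega)) (by omega)
  · exact hpvc m 0 1 (by omega) rfl (hasBalancedColouring_two_of_add_two_le hmono h')
      fun _ => not_hasBalancedColouring_one (by omega) (by omega)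
  · exact hpvc m 0 1 (by omega) rfl
      (hasBalancedColouring_two_of_add_le ht hpos hmono (by omega))
      fun _ => not_hasBalancedColouring_one (by omega) (by omega)
  · exact hpvc m 0 2 (by omega) rfl (hasBalancedColouring_three ht hmono (by omega) h')
      fun _ => not_hasBalancedColouring_two ht (by omega)
  · exact hpvc m 0 3 (by omega) rfl
      (hasBalancedColouring_of_le (fun i hi hit => (hle i hi hit).trans a.le) (by omega))
      fun _ => not_hasBalancedColouring_three h a b c d
  · have hnt2 : n t = 2 := h t (by omega) le_rfl (by omega)
    obtain ⟨r, rfl⟩ : ∃ r, s = r + 1 := ⟨s - 1, by omega⟩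
    refine hpvc m 0 r (by omega) rfl ?_ fun _ => ?_
    · rw [hnt2]
      exact hasBalancedColouring_of_two hs h h'
    · rw [hnt2]
      exact not_hasBalancedColouring_of_two (Nat.lt_succ_self r) hst h
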